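/- \textbf{Setting.} Let $S$ and $A$ be finite sets of states and actions and let $H\ge 1$ be the horizon. A tabular episodic MDP has transition functions $P_h(\cdot\mid s,a)$, rewards $r_h(s,a)\in[0,1]$ ($h\in[H]$) and an initial distribution $\rho$. A policy is a family $\pi=(\pi_h(\cdot\mid s))_{h\in[H],\,s\in S}$ of distributions on $A$. It induces a law of trajectories $(s_1,a_1,\dots,s_H,a_H)$. Let $P^\pi_h(s,a)$ and $P^\pi_h(s)$ be the laws of $(s_h,a_h)$ and $s_h$, and let $V^\pi=\mathbb E_\pi\big[\sum_{h=1}^H r_h(s_h,a_h)\big]$. The MDP is a \emph{Reset Cliff} MDP with expert action $a^1$ and deterministic expert policy $\pi^E$ if $S$ is a disjoint union $S=S^G\cup S^B$ of good and bad states such that: (i) $\rho$ is supported on $S^G$, and $\pi^E_h(s)=a^1$ for all $h$ and $s\in S^G$; (ii) $r_h(s,a)=1$ if $s\in S^G$ and $a=a^1$, and $r_h(s,a)=0$ otherwise; (iii) for all $h$ and $s\in S^G$: $\sum_{s'\in S^G}P_h(s'\mid s,a^1)=1$, $P_h(s'\mid s,a^1)>0$ for every $s'\in S^G$, and $\sum_{s'\in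 S^B}P_h(s'\mid s,a)=1$ for every $a\ne a^1$; (iv) $\sum_{s'\in S^B}P_h(s'\mid s,a)=1$ for all $h$, $s\in S^B$, $a\in A$. Given a dataset of $m\ge1$ trajectories, $\widehat P^{\pi^E}_h(s,a)$ is the fraction of trajectories with $(s_h,a_h)=(s,a)$, and $\widehat P^{\pi^E}_h(s)=\sum_a\widehat P^{\pi^E}_h(s,a)$. VAIL outputs any global minimiser $\pi^{\mathrm{AIL}}$ over all policies of $$\pi\longmapsto\sum_{h=1}^H\sum_{(s,a)\in S\times A}\big|P^\pi_h(s,a)-\widehat P^{\pi^E}_h(s,a)\big|.$$ \textbf{Theorem.} Consider a Reset Cliff MDP and $m\ge 1$. (a) For every dataset of $m$ trajectories, each of positive probability under $\pi^E$, every VAIL output $\pi^{\mathrm{AIL}}$ satisfies $P^{\pi^{\mathrm{AIL}}}_h(s,a)=P^{\pi^E}_h(s,a)$ for all $h<H$ and all $(s,a)$. The value gap therefore comes from the last step only: $$V^{\pi^E}-V^{\pi^{\mathrm{AIL}}}=\sum_{(s,a)}\big(P^{\pi^E}_H(s,a)-P^{\pi^{\mathrm{AIL}}}_H(s,a)\big)\,r_H(s,a),$$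 and $$\big|V^{\pi^E}-V^{\pi^{\mathrm{AIL}}}\big|\le 2\,\big\|\widehat P^{\pi^E}_H-P^{\pi^E}_H\big\|_1 = 2\sum_{s\in S}\big|\widehat P^{\pi^E}_H(s)-P^{\pi^E}_H(s)\big|.$$ Now let the dataset consist of $m$ i.i.d. trajectories of $\pi^E$, and let $\pi^{\mathrm{AIL}}$ be a (measurable, possibly further randomised) VAIL output that is almost surely a minimiser for this dataset. (b) (In expectation.) For every $\varepsilon>0$, if $m\ge 4|S|/\varepsilon^2$, then $V^{\pi^E}-\mathbb E\big[V^{\pi^{\mathrm{AIL}}}\big]\le\varepsilon$. Thus $O(|S|/\varepsilon^2)$ expert trajectories suffice, independently of $H$. (c) (With high probability.) For every $\varepsilon>0$ and $\delta\in(0,1)$, if $m\ge 8|S|\log(2/\delta)/\varepsilon^2$, then $V^{\pi^E}-V^{\pi^{\mathrm{AIL}}}\le\varepsilon$ with probability at least $1-\delta$. Thus $\widetilde O(|S|/\varepsilon^2)$ expert trajectories suffice, independently of $H$. -/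

import Mathlib

open MeasureTheory ProbabilityTheory

namespace Imitation

/-- A tabular episodic Markov decision process with horizon `H`, time steps indexed by `Fin H`:
transition functions, deterministic rewards in `[0, 1]` and an initial state distribution.
(The transition function of the last step plays no role in an episode.) -/
structure MDP (S A : Type*) [Fintype S] (H : ℕ) where
  trans : Fin H → S → A → S → ℝ
  trans_nonneg : ∀ h s a s', 0 ≤ trans h s a s'
  trans_sum : ∀ h s a, ∑ s', trans h s a s' = 1
  reward : Fin H → S → A → ℝ
  reward_nonneg : ∀ h s a, 0 ≤ reward h s a
  reward_le_one : ∀ h s a, reward h s a ≤ 1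
  init : S → ℝ
  init_nonneg : ∀ s, 0 ≤ init s
  init_sum : ∑ s, init s = 1

/-- A (time-dependent, stochastic) policy: `prob h s a` is the probability `π_h(a | s)`. -/
structure Policy (S A : Type*) [Fintype A] (H : ℕ) where
  prob : Fin H → S → A → ℝ
  prob_nonneg : ∀ h s a, 0 ≤ prob h s a
  prob_sum : ∀ h s, ∑ a, prob h s a = 1

/-- A trajectory `(s_1, a_1, …, s_H, a_H)`. -/
abbrev Trajectory (S A : Type*) (H : ℕ) := Fin H → S × A

/-- The last time step of a horizon `H ≥ 1`. -/
def lastStep (H : ℕ) [NeZero H] : Fin H := ⟨H - 1, Nat.sub_one_lt (NeZero.ne H)⟩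

variable {S A : Type*} [Fintype S] [Fintype A] [DecidableEq S] [DecidableEq A] {H : ℕ}

/-- The policy which takes the action `f h s` with probability one. -/
noncomputable def Policy.deterministic (f : Fin H → S → A) : Policy S A H where
  prob h s a := if a = f h s then 1 else 0
  prob_nonneg h s a := by split_ifs <;> norm_num
  prob_sum h s := by simp

/-- The probability of the trajectory `τ` when policy `π` is run for one episode:
`ρ(s_1) ∏_{h ≤ H} π_h(a_h | s_h) ∏_{h < H} P_h(s_{h+1} | s_h, a_h)`. -/
noncomputable def MDP.trajProb [NeZero H] (M : MDP S A H) (π : Policy S A H)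
    (τ : Trajectory S A H) : ℝ :=
  M.init (τ 0).1 * (∏ h, π.prob h (τ h).1 (τ h).2) *
    ∏ h : Fin H, if hh : (h : ℕ) + 1 < H
      then M.trans h (τ h).1 (τ h).2 (τ ⟨h + 1, hh⟩).1 else 1

/-- The state-action distribution `P^π_h(s, a)`: the probability that `(s_h, a_h) = (s, a)`. -/
noncomputable def MDP.occ [NeZero H] (M : MDP S A H) (π : Policy S A H)
    (h : Fin H) (s : S) (a : A) : ℝ :=
  ∑ τ : Trajectory S A H with τ h = (s, a), M.trajProb π τ

/-- The state distribution `P^π_h(s)`. -/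
noncomputable def MDP.stateOcc [NeZero H] (M : MDP S A H) (π : Policy S A H)
    (h : Fin H) (s : S) : ℝ :=
  ∑ a, M.occ π h s a

/-- The policy value `V^π`: the expected sum of the rewards of one episode. -/
noncomputable def MDP.value [NeZero H] (M : MDP S A H) (π : Policy S A H) : ℝ :=
  ∑ τ : Trajectory S A H, M.trajProb π τ * ∑ h, M.reward h (τ h).1 (τ h).2

/-- The maximum likelihood estimate `P̂_h(s, a)` from `m` trajectories: the fraction of them that
have `(s_h, a_h) = (s, a)`. -/
noncomputable def empirical {m : ℕ} (D : Fin m → Trajectory S A H)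
    (h : Fin H) (s : S) (a : A) : ℝ :=
  ((Finset.univ.filter fun i => D i h = (s, a)).card : ℝ) / m

/-- The empirical state distribution `P̂_h(s)`. -/
noncomputable def empiricalState {m : ℕ} (D : Fin m → Trajectory S A H)
    (h : Fin H) (s : S) : ℝ :=
  ∑ a, empirical D h s a

/-- The objective of VAIL (adversarial imitation learning by state-action distribution matching):
`∑_h ∑_{(s,a)} |P^π_h(s, a) - P̂_h(s, a)|`. -/
noncomputable def MDP.vailLoss [NeZero H] (M : MDP S A H) {m : ℕ}
    (D : Fin m → Trajectory S A H) (π : Policy S A H) : ℝ :=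
  ∑ h, ∑ s, ∑ a, |M.occ π h s a - empirical D h s a|

/-- `π` is a possible output of VAIL on the dataset `D`: a global minimiser of the objective over
all policies. -/
def MDP.IsVAIL [NeZero H] (M : MDP S A H) {m : ℕ}
    (D : Fin m → Trajectory S A H) (π : Policy S A H) : Prop :=
  ∀ π' : Policy S A H, M.vailLoss D π ≤ M.vailLoss D π'

/-- `M` is a Reset Cliff MDP with set of good states `good` (the other states are bad), expert
action `a₁` and deterministic expert policy `πE`. -/
structure MDP.IsResetCliff (M : MDP S A H) (good : Finset S) (a₁ : A)
    (πE : Fin H → S → A) : Prop where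
  expert_action : ∀ h, ∀ s ∈ good, πE h s = a₁
  init_good : ∀ s ∉ good, M.init s = 0
  reward_eq : ∀ h s a, M.reward h s a = if s ∈ good ∧ a = a₁ then 1 else 0
  expert_stays_good : ∀ h, ∀ s ∈ good, ∑ s' ∈ good, M.trans h s a₁ s' = 1
  expert_mixes : ∀ h, ∀ s ∈ good, ∀ s' ∈ good, 0 < M.trans h s a₁ s'
  other_falls : ∀ h, ∀ s ∈ good, ∀ a, a ≠ a₁ → ∑ s' ∈ goodᶜ, M.trans h s a s' = 1
  bad_absorbs : ∀ h, ∀ s ∉ good, ∀ a, ∑ s' ∈ goodᶜ, M.trans h s a s' = 1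

/-- Under the probability measure `μ`, the random dataset `D` consists of `m` independent
trajectories, each collected by running `π`. -/
structure MDP.IsSample [NeZero H] (M : MDP S A H) (π : Policy S A H)
    {Ω : Type*} [MeasurableSpace Ω] (μ : Measure Ω) {m : ℕ}
    (D : Fin m → Ω → Trajectory S A H) : Prop where
  measurableSet_eq : ∀ i τ, MeasurableSet {ω | D i ω = τ}
  indep : iIndepFun (m := fun _ => (⊤ : MeasurableSpace (Trajectory S A H))) D μ
  law : ∀ i τ, μ.real {ω | D i ω = τ} = M.trajProb π τ

end Imitation

set_option linter.unusedSectionVars false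

/-! Good states are reached only from good states through `a₁`, and the expert always plays `a₁`
there. By induction on the step, every policy has occupancy `x ≤ e` at each good pair `(s, a₁)`,
where `e` is the expert's occupancy (`occ_le_expert`).

The data put no mass `p` elsewhere and each step carries total mass one, so the loss is the sum of
`|x - p| - x` over good pairs plus the constant `H` (`vailLoss_eq`). This function of `x` decreases
strictly up to `p` and is constant afterwards. Hence the expert is itself a minimiser, and a
minimiser can have `x < e` only where `p ≤ x`.

A deviation before the last step spreads by mixing to every good state of the last step. There `p ≤
x < e` everywhere, yet `p` and `e` both have sum one: a contradiction. Only the last step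
contributes to the gap, by at most the sum of the positive parts of `e - p` (`value_gap_le`). A
second moment bound controls this sum in expectation. With high probability it is controlled by
Hoeffding's inequality and a union bound over all sets of states. -/

namespace Imitation

section

/-! ### Marginals of a finite inhomogeneous Markov chain -/

section PathWeight

variable {X : Type*}

/-- The weight of a path of a time-inhomogeneous Markov chain with initial weights `w` and
transition weights `K`. -/
def pathWeight {n : ℕ} (w : X → ℝ) (K : Fin n → X → X → ℝ) (τ : Fin (n + 1) → X) : ℝ :=
  w (τ 0) * ∏ i : Fin n, K i (τ i.castSucc) (τ i.succ)

variable [Fintype X] [DecidableEq X]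

/-- The marginal weights at time `h` of the paths of a Markov chain. -/
def pathMarginal {n : ℕ} (w : X → ℝ) (K : Fin n → X → X → ℝ) (h : Fin (n + 1)) (x : X) : ℝ :=
  ∑ τ : Fin (n + 1) → X, if τ h = x then pathWeight w K τ else 0

lemma pathWeight_snoc {n : ℕ} (w : X → ℝ) (K : Fin (n + 1) → X → X → ℝ) (τ : Fin (n + 1) → X)
    (y : X) :
    pathWeight w K (Fin.snoc τ y : Fin (n + 2) → X) =
      pathWeight w (fun i => K i.castSucc) τ * K (Fin.last n) (τ (Fin.last n)) y := by
  unfold pathWeight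
  have h0 : (Fin.snoc τ y : Fin (n + 2) → X) 0 = τ 0 := by
    rw [← Fin.castSucc_zero, Fin.snoc_castSucc (α := fun _ => X)]
  rw [Fin.prod_univ_castSucc, h0]
  have h1 : ∀ i : Fin n, (Fin.snoc τ y : Fin (n + 2) → X) i.castSucc.succ = τ i.succ := fun i => by
    rw [Fin.succ_castSucc, Fin.snoc_castSucc (α := fun _ => X)]
  simp only [Fin.snoc_castSucc (α := fun _ => X), h1, Fin.succ_last,
    Fin.snoc_last (α := fun _ => X)]
  ring

lemma sum_snoc {n : ℕ} (f : (Fin (n + 1) → X) → ℝ) :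
    ∑ τ, f τ = ∑ τ : Fin n → X, ∑ y, f (Fin.snoc τ y) := by
  rw [← Equiv.sum_comp (Fin.snocEquiv fun _ => X) f, Fintype.sum_prod_type, Finset.sum_comm]
  rfl

/-- The final coordinate sums out because the rows of `K` sum to one. -/
lemma pathMarginal_castSucc {n : ℕ} (w : X → ℝ) (K : Fin (n + 1) → X → X → ℝ)
    (hK : ∀ i x, ∑ y, K i x y = 1) (h : Fin (n + 1)) (x : X) :
    pathMarginal w K h.castSucc x = pathMarginal w (fun i => K i.castSucc) h x := by
  unfold pathMarginal
  rw [sum_snoc]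
  refine Finset.sum_congr rfl fun τ _ => ?_
  simp only [Fin.snoc_castSucc (α := fun _ => X), pathWeight_snoc]
  split_ifs
  · rw [← Finset.mul_sum, hK, mul_one]
  · simp

lemma pathMarginal_last {n : ℕ} (w : X → ℝ) (K : Fin (n + 1) → X → X → ℝ) (y : X) :
    pathMarginal w K (Fin.last (n + 1)) y =
      ∑ x, pathMarginal w (fun i => K i.castSucc) (Fin.last n) x * K (Fin.last n) x y := by
  unfold pathMarginal
  rw [sum_snoc]
  simp only [Fin.snoc_last (α := fun _ => X), pathWeight_snoc, Finset.sum_mul]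
  rw [Finset.sum_comm]
  conv_rhs => rw [Finset.sum_comm]
  simp [Finset.sum_ite_eq]

lemma pathMarginal_zero {n : ℕ} (w : X → ℝ) (K : Fin n → X → X → ℝ)
    (hK : ∀ i x, ∑ y, K i x y = 1) (x : X) : pathMarginal w K 0 x = w x := by
  induction n with
  | zero =>
    unfold pathMarginal pathWeight
    rw [← Equiv.sum_comp (Equiv.funUnique (Fin 1) X).symm]
    simp
  | succ n ih =>
    rw [← Fin.castSucc_zero, pathMarginal_castSucc w K hK]
    exact ih _ fun i => hK _

/-- Peeling off the final coordinate gives the recursion at the last time; at earlier times it is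
inherited from the truncated chain. -/
lemma pathMarginal_succ {n : ℕ} (w : X → ℝ) (K : Fin n → X → X → ℝ)
    (hK : ∀ i x, ∑ y, K i x y = 1) (i : Fin n) (y : X) :
    pathMarginal w K i.succ y = ∑ x, pathMarginal w K i.castSucc x * K i x y := by
  induction n with
  | zero => exact i.elim0
  | succ n ih =>
    induction i using Fin.lastCases with
    | last =>
      rw [Fin.succ_last, pathMarginal_last]
      simp only [pathMarginal_castSucc w K hK]
    | cast j =>
      rw [Fin.succ_castSucc, pathMarginal_castSucc w K hK, ih _ fun i => hK _]
      simp only [pathMarginal_castSucc w K hK]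

end PathWeight

/-! ### Forward recursion for occupancies -/

variable {S A : Type*} [Fintype S] [Fintype A] [DecidableEq S] [DecidableEq A] {H : ℕ}

/-- The initial state-action weights of the Markov chain induced by a policy. -/
def MDP.chainInit {n : ℕ} (M : MDP S A (n + 1)) (π : Policy S A (n + 1)) (x : S × A) : ℝ :=
  M.init x.1 * π.prob 0 x.1 x.2

/-- The transition weights of the Markov chain on state-action pairs induced by a policy. -/
def MDP.chainTrans {n : ℕ} (M : MDP S A (n + 1)) (π : Policy S A (n + 1)) (i : Fin n)
    (x y : S × A) : ℝ :=
  M.trans i.castSucc x.1 x.2 y.1 * π.prob i.succ y.1 y.2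

lemma MDP.sum_chainTrans {n : ℕ} (M : MDP S A (n + 1)) (π : Policy S A (n + 1)) (i : Fin n)
    (x : S × A) : ∑ y, M.chainTrans π i x y = 1 := by
  simp only [chainTrans, Fintype.sum_prod_type, ← Finset.mul_sum, π.prob_sum, mul_one, M.trans_sum]

/-- Each action probability is grouped with the transition into its state; the default factor 1 in
`trajProb` occurs only at the last index. -/
lemma MDP.trajProb_eq_pathWeight {n : ℕ} [NeZero (n + 1)] (M : MDP S A (n + 1))
    (π : Policy S A (n + 1)) (τ : Trajectory S A (n + 1)) :
    M.trajProb π τ = pathWeight (M.chainInit π) (M.chainTrans π) τ := by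
  unfold trajProb pathWeight chainInit chainTrans
  rw [Fin.prod_univ_succ, Fin.prod_univ_castSucc (n := n), Finset.prod_mul_distrib]
  have h1 : ∀ i : Fin n, (if hh : ((i.castSucc : Fin (n + 1)) : ℕ) + 1 < n + 1 then
      M.trans i.castSucc (τ i.castSucc).1 (τ i.castSucc).2 (τ ⟨(i.castSucc : ℕ) + 1, hh⟩).1 else 1)
      = M.trans i.castSucc (τ i.castSucc).1 (τ i.castSucc).2 (τ i.succ).1 := fun i => by
    have hi : ((i.castSucc : Fin (n + 1)) : ℕ) + 1 < n + 1 := by simp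
    rw [dif_pos hi]
    rfl
  rw [Finset.prod_congr rfl fun i _ => h1 i]
  simp
  ring

lemma MDP.occ_eq_pathMarginal {n : ℕ} [NeZero (n + 1)] (M : MDP S A (n + 1))
    (π : Policy S A (n + 1)) (h : Fin (n + 1)) (s : S) (a : A) :
    M.occ π h s a = pathMarginal (M.chainInit π) (M.chainTrans π) h (s, a) := by
  unfold occ pathMarginal
  rw [Finset.sum_filter]
  simp only [M.trajProb_eq_pathWeight]

variable [NeZero H]

lemma MDP.trajProb_nonneg (M : MDP S A H) (π : Policy S A H) (τ : Trajectory S A H) :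
    0 ≤ M.trajProb π τ := by
  unfold trajProb
  refine mul_nonneg (mul_nonneg (M.init_nonneg _) (Finset.prod_nonneg fun _ _ => π.prob_nonneg _ _ _))
    (Finset.prod_nonneg fun _ _ => ?_)
  split_ifs
  · exact M.trans_nonneg _ _ _ _
  · exact zero_le_one

lemma MDP.occ_nonneg (M : MDP S A H) (π : Policy S A H) (h : Fin H) (s : S) (a : A) :
    0 ≤ M.occ π h s a :=
  Finset.sum_nonneg fun _ _ => M.trajProb_nonneg π _

lemma MDP.occ_zero (M : MDP S A H) (π : Policy S A H) (s : S) (a : A) :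
    M.occ π 0 s a = M.init s * π.prob 0 s a := by
  obtain ⟨n, rfl⟩ := Nat.exists_eq_succ_of_ne_zero (NeZero.ne H)
  rw [M.occ_eq_pathMarginal]
  exact pathMarginal_zero _ _ (M.sum_chainTrans π) _

lemma MDP.occ_succ (M : MDP S A H) (π : Policy S A H) {k : ℕ} (hk : k + 1 < H) (s' : S) (a' : A) :
    M.occ π ⟨k + 1, hk⟩ s' a' =
      (∑ s, ∑ a, M.occ π ⟨k, by omega⟩ s a * M.trans ⟨k, by omega⟩ s a s') *
        π.prob ⟨k + 1, hk⟩ s' a' := by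
  obtain ⟨n, rfl⟩ := Nat.exists_eq_succ_of_ne_zero (NeZero.ne H)
  simp only [M.occ_eq_pathMarginal]
  have := pathMarginal_succ (M.chainInit π) _ (M.sum_chainTrans π) ⟨k, by omega⟩ (s', a')
  rw [Fintype.sum_prod_type] at this
  simp only [Finset.sum_mul, mul_assoc]
  exact this

lemma MDP.stateOcc_zero (M : MDP S A H) (π : Policy S A H) (s : S) :
    M.stateOcc π 0 s = M.init s := by
  simp only [stateOcc, M.occ_zero, ← Finset.mul_sum, π.prob_sum, mul_one]

lemma MDP.stateOcc_succ (M : MDP S A H) (π : Policy S A H) {k : ℕ} (hk : k + 1 < H) (s' : S) :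
    M.stateOcc π ⟨k + 1, hk⟩ s' =
      ∑ s, ∑ a, M.occ π ⟨k, by omega⟩ s a * M.trans ⟨k, by omega⟩ s a s' := by
  simp only [stateOcc, M.occ_succ, ← Finset.mul_sum, π.prob_sum, mul_one]

lemma MDP.occ_eq_stateOcc_mul (M : MDP S A H) (π : Policy S A H) (h : Fin H) (s : S) (a : A) :
    M.occ π h s a = M.stateOcc π h s * π.prob h s a := by
  obtain ⟨k, hk⟩ := h
  cases k with
  | zero =>
    have : (⟨0, hk⟩ : Fin H) = 0 := rfl
    rw [this, M.occ_zero, M.stateOcc_zero]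
  | succ k => rw [M.occ_succ, M.stateOcc_succ]

lemma MDP.sum_trajProb_mul (M : MDP S A H) (π : Policy S A H) (h : Fin H) (f : S × A → ℝ) :
    ∑ τ, M.trajProb π τ * f (τ h) = ∑ s, ∑ a, M.occ π h s a * f (s, a) := by
  rw [← Fintype.sum_prod_type fun x : S × A => M.occ π h x.1 x.2 * f x]
  simp only [occ, Finset.sum_filter, Finset.sum_mul]
  rw [Finset.sum_comm]
  simp

lemma MDP.sum_stateOcc (M : MDP S A H) (π : Policy S A H) (h : Fin H) :
    ∑ s, M.stateOcc π h s = 1 := by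
  -- The total trajectory mass does not depend on the step, so it can be evaluated at step 0.
  have key : ∀ h, ∑ s, M.stateOcc π h s = ∑ τ, M.trajProb π τ := fun h => by
    simpa [stateOcc] using (M.sum_trajProb_mul π h fun _ => 1).symm
  rw [key, ← key 0]
  simp only [M.stateOcc_zero, M.init_sum]

lemma MDP.sum_trajProb (M : MDP S A H) (π : Policy S A H) : ∑ τ, M.trajProb π τ = 1 := by
  have := M.sum_trajProb_mul π 0 fun _ => 1
  simp only [mul_one] at this
  rw [this]
  exact M.sum_stateOcc π 0

lemma MDP.value_eq (M : MDP S A H) (π : Policy S A H) :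
    M.value π = ∑ h, ∑ s, ∑ a, M.occ π h s a * M.reward h s a := by
  unfold value
  simp only [Finset.mul_sum]
  rw [Finset.sum_comm]
  exact Finset.sum_congr rfl fun h _ =>
    M.sum_trajProb_mul π h fun x => M.reward h x.1 x.2

end

/-! ### Empirical distributions and the scalar loss -/

section

variable {S A : Type*} [Fintype S] [Fintype A] [DecidableEq S] [DecidableEq A] {H : ℕ}

section Empirical

variable {m : ℕ} (D : Fin m → Trajectory S A H)

lemma empirical_eq_sum (h : Fin H) (s : S) (a : A) :
    empirical D h s a = (∑ i, if D i h = (s, a) then (1 : ℝ) else 0) / m := by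
  simp [empirical]

lemma empiricalState_eq_sum (h : Fin H) (s : S) :
    empiricalState D h s = (∑ i, if (D i h).1 = s then (1 : ℝ) else 0) / m := by
  simp only [empiricalState, empirical_eq_sum, ← Finset.sum_div]
  rw [Finset.sum_comm]
  congr 1
  refine Finset.sum_congr rfl fun i _ => ?_
  by_cases hs : (D i h).1 = s
  · simp [hs, Prod.ext_iff]
  · simp [hs, Prod.ext_iff]

lemma sum_empiricalState (hm : 0 < m) (h : Fin H) : ∑ s, empiricalState D h s = 1 := by
  simp only [empiricalState_eq_sum, ← Finset.sum_div]
  rw [Finset.sum_comm]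
  simp [hm.ne']

lemma empirical_eq_zero {h : Fin H} {s : S} {a : A} (hD : ∀ i, D i h ≠ (s, a)) :
    empirical D h s a = 0 := by
  simp [empirical, hD]

end Empirical

/-- Monotonicity of `x ↦ |x - p| - x`, which makes larger occupancies never worse. -/
lemma abs_sub_sub_self_le {x e : ℝ} (p : ℝ) (hxe : x ≤ e) : |e - p| - e ≤ |x - p| - x := by
  cases abs_cases (e - p) <;> cases abs_cases (x - p) <;> linarith

/-- Below `p` the function has slope `-2`, so a tie is possible only on its flat part. -/
lemma le_of_abs_sub_sub_self_eq {x e p : ℝ} (hxe : x < e) (h : |e - p| - e = |x - p| - x) :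
    p ≤ x := by
  cases abs_cases (e - p) <;> cases abs_cases (x - p) <;> linarith

/-- The steps before the last one precede it. -/
lemma lt_of_ne_lastStep [NeZero H] {h : Fin H} (hh : h ≠ lastStep H) : (h : ℕ) < H - 1 := by
  have := h.isLt
  have : (h : ℕ) ≠ H - 1 := fun h' => hh (Fin.ext h')
  omega

lemma sum_sum_ite_mem_and_eq (good : Finset S) (a₁ : A) (F : S → A → ℝ) :
    ∑ s, ∑ a, (if s ∈ good ∧ a = a₁ then F s a else 0) = ∑ s ∈ good, F s a₁ := by
  simp [ite_and, Finset.sum_ite_mem]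

/-! ### Domination of every policy by the expert -/

namespace MDP.IsResetCliff

variable {M : MDP S A H} {good : Finset S} {a₁ : A} {πE : Fin H → S → A}

lemma trans_eq_zero (hM : M.IsResetCliff good a₁ πE) {h : Fin H} {s s' : S} {a : A}
    (hs' : s' ∈ good) (hsa : ¬(s ∈ good ∧ a = a₁)) : M.trans h s a s' = 0 := by
  have h1 : ∑ s' ∈ goodᶜ, M.trans h s a s' = 1 := by
    by_cases hs : s ∈ good
    · exact hM.other_falls h s hs a fun ha => hsa ⟨hs, ha⟩
    · exact hM.bad_absorbs h s hs a
  have h2 := Finset.sum_add_sum_compl good (M.trans h s a)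
  rw [M.trans_sum, h1] at h2
  have h3 : ∑ s' ∈ good, M.trans h s a s' = 0 := by linarith
  exact (Finset.sum_eq_zero_iff_of_nonneg fun _ _ => M.trans_nonneg _ _ _ _).1 h3 s' hs'

variable [NeZero H]

lemma stateOcc_succ (hM : M.IsResetCliff good a₁ πE) (π : Policy S A H) {k : ℕ} (hk : k + 1 < H)
    {s' : S} (hs' : s' ∈ good) :
    M.stateOcc π ⟨k + 1, hk⟩ s' =
      ∑ s ∈ good, M.occ π ⟨k, by omega⟩ s a₁ * M.trans ⟨k, by omega⟩ s a₁ s' := by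
  rw [M.stateOcc_succ, ← sum_sum_ite_mem_and_eq good a₁ fun s a =>
    M.occ π ⟨k, by omega⟩ s a * M.trans ⟨k, by omega⟩ s a s']
  refine Finset.sum_congr rfl fun s _ => Finset.sum_congr rfl fun a _ => ?_
  split_ifs with hsa
  · rfl
  · rw [hM.trans_eq_zero hs' hsa, mul_zero]

lemma occ_expert (hM : M.IsResetCliff good a₁ πE) (h : Fin H) {s : S} (hs : s ∈ good) :
    M.occ (Policy.deterministic πE) h s a₁ = M.stateOcc (Policy.deterministic πE) h s := by
  rw [M.occ_eq_stateOcc_mul]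
  simp [Policy.deterministic, hM.expert_action h s hs]

lemma occ_le_stateOcc (M : MDP S A H) (π : Policy S A H) (h : Fin H) (s : S) (a : A) :
    M.occ π h s a ≤ M.stateOcc π h s :=
  Finset.single_le_sum (f := fun a => M.occ π h s a) (fun a _ => M.occ_nonneg π h s a)
    (Finset.mem_univ a)

lemma sum_stateOcc_expert (hM : M.IsResetCliff good a₁ πE) (h : Fin H) :
    ∑ s ∈ good, M.stateOcc (Policy.deterministic πE) h s = 1 := by
  obtain ⟨k, hk⟩ := h
  induction k with
  | zero =>
    have : (⟨0, hk⟩ : Fin H) = 0 := rfl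
    simp only [this, M.stateOcc_zero]
    rw [← M.init_sum]
    exact Finset.sum_subset (Finset.subset_univ _) fun s _ hs => hM.init_good s hs
  | succ k ih =>
    have h1 := fun s' (hs' : s' ∈ good) => hM.stateOcc_succ (Policy.deterministic πE) hk hs'
    rw [Finset.sum_congr rfl h1, Finset.sum_comm, ← ih (by omega)]
    refine Finset.sum_congr rfl fun s hs => ?_
    rw [← Finset.mul_sum, hM.expert_stays_good _ s hs, mul_one, hM.occ_expert _ hs]

lemma sum_occ_expert (hM : M.IsResetCliff good a₁ πE) (h : Fin H) :
    ∑ s ∈ good, M.occ (Policy.deterministic πE) h s a₁ = 1 := by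
  rw [← hM.sum_stateOcc_expert h]
  exact Finset.sum_congr rfl fun s hs => hM.occ_expert h hs

/-- The whole unit of mass is already used up on good pairs. This serves the expert and any policy
that matches it there. -/
lemma occ_eq_zero {π : Policy S A H} {h : Fin H}
    (hsum : ∑ s ∈ good, M.occ π h s a₁ = 1) {s : S} {a : A} (hsa : ¬(s ∈ good ∧ a = a₁)) :
    M.occ π h s a = 0 := by
  have h1 : ∑ s, ∑ a, (if s ∈ good ∧ a = a₁ then 0 else M.occ π h s a) = 0 := by
    have h2 : ∑ s, ∑ a, M.occ π h s a = 1 := M.sum_stateOcc π h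
    rw [← sum_sum_ite_mem_and_eq] at hsum
    refine Eq.trans ?_ (sub_eq_zero.2 (h2.trans hsum.symm))
    simp only [← Finset.sum_sub_distrib]
    refine Finset.sum_congr rfl fun s _ => Finset.sum_congr rfl fun a _ => ?_
    split_ifs <;> simp
  have h3 : ∀ s a, 0 ≤ (if s ∈ good ∧ a = a₁ then 0 else M.occ π h s a) := fun s a => by
    split_ifs
    · exact le_rfl
    · exact M.occ_nonneg π h s a
  have h4 := (Finset.sum_eq_zero_iff_of_nonneg fun s _ =>
    Finset.sum_nonneg fun a _ => h3 s a).1 h1 s (Finset.mem_univ s)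
  have h5 := (Finset.sum_eq_zero_iff_of_nonneg fun a _ => h3 s a).1 h4 a (Finset.mem_univ a)
  rwa [if_neg hsa] at h5

lemma stateOcc_le_expert (hM : M.IsResetCliff good a₁ πE) (π : Policy S A H) (h : Fin H) {s : S}
    (hs : s ∈ good) : M.stateOcc π h s ≤ M.stateOcc (Policy.deterministic πE) h s := by
  obtain ⟨k, hk⟩ := h
  induction k generalizing s with
  | zero =>
    have : (⟨0, hk⟩ : Fin H) = 0 := rfl
    simp only [this, M.stateOcc_zero, le_refl]
  | succ k ih =>
    rw [hM.stateOcc_succ _ hk hs, hM.stateOcc_succ _ hk hs]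
    refine Finset.sum_le_sum fun s hs => ?_
    rw [hM.occ_expert _ hs]
    exact mul_le_mul_of_nonneg_right ((occ_le_stateOcc M π _ s a₁).trans (ih hs (by omega)))
      (M.trans_nonneg _ _ _ _)

lemma occ_le_expert (hM : M.IsResetCliff good a₁ πE) (π : Policy S A H) (h : Fin H) {s : S}
    (hs : s ∈ good) : M.occ π h s a₁ ≤ M.occ (Policy.deterministic πE) h s a₁ := by
  rw [hM.occ_expert h hs]
  exact (occ_le_stateOcc M π h s a₁).trans (hM.stateOcc_le_expert π h hs)

/-- A deviation from the expert is propagated to all good states of the next step. -/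
lemma occ_succ_lt_expert (hM : M.IsResetCliff good a₁ πE) (π : Policy S A H) {k : ℕ}
    (hk : k + 1 < H) {s : S} (hs : s ∈ good)
    (hlt : M.occ π ⟨k, by omega⟩ s a₁ < M.occ (Policy.deterministic πE) ⟨k, by omega⟩ s a₁)
    {s' : S} (hs' : s' ∈ good) :
    M.occ π ⟨k + 1, hk⟩ s' a₁ < M.occ (Policy.deterministic πE) ⟨k + 1, hk⟩ s' a₁ := by
  rw [hM.occ_expert _ hs']
  refine (occ_le_stateOcc M π _ s' a₁).trans_lt ?_
  rw [hM.stateOcc_succ _ hk hs', hM.stateOcc_succ _ hk hs']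
  refine Finset.sum_lt_sum (fun s hs => mul_le_mul_of_nonneg_right (hM.occ_le_expert π _ hs)
    (M.trans_nonneg _ _ _ _)) ⟨s, hs, ?_⟩
  exact mul_lt_mul_of_pos_right hlt (hM.expert_mixes _ s hs s' hs')

lemma occ_lt_expert_of_lt (hM : M.IsResetCliff good a₁ πE) (π : Policy S A H) {k j : ℕ}
    (hkj : k + 1 ≤ j) (hj : j < H) {s : S} (hs : s ∈ good)
    (hlt : M.occ π ⟨k, by omega⟩ s a₁ < M.occ (Policy.deterministic πE) ⟨k, by omega⟩ s a₁) :
    ∀ s' ∈ good, M.occ π ⟨j, hj⟩ s' a₁ < M.occ (Policy.deterministic πE) ⟨j, hj⟩ s' a₁ := by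
  induction j, hkj using Nat.le_induction with
  | base => exact fun s' hs' => hM.occ_succ_lt_expert π hj hs hlt hs'
  | succ j hkj ih =>
    -- After one step all good states deviate, so `s` itself serves again as the witness.
    exact fun s' hs' => hM.occ_succ_lt_expert π hj hs (ih (by omega) hlt s hs) hs'

lemma value_eq (hM : M.IsResetCliff good a₁ πE) (π : Policy S A H) :
    M.value π = ∑ h, ∑ s ∈ good, M.occ π h s a₁ := by
  rw [M.value_eq]
  refine Finset.sum_congr rfl fun h _ => ?_
  rw [← sum_sum_ite_mem_and_eq]
  refine Finset.sum_congr rfl fun s _ => Finset.sum_congr rfl fun a _ => ?_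
  rw [hM.reward_eq]
  split_ifs <;> simp

/-- The expert only visits good states, and takes the expert action there. -/
lemma mem_good_of_trajProb_pos (hM : M.IsResetCliff good a₁ πE) {τ : Trajectory S A H}
    (hτ : 0 < M.trajProb (Policy.deterministic πE) τ) (h : Fin H) :
    (τ h).1 ∈ good ∧ (τ h).2 = a₁ := by
  by_contra hsa
  have h0 := occ_eq_zero (hM.sum_occ_expert h) hsa
  have := (Finset.sum_eq_zero_iff_of_nonneg fun _ _ => M.trajProb_nonneg _ _).1 h0 τ (by simp)
  exact hτ.ne' this

/-! ### Minimisers of the matching loss -/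

section Dataset

variable {m : ℕ} {D : Fin m → Trajectory S A H}

lemma empirical_eq_zero (hM : M.IsResetCliff good a₁ πE)
    (hD : ∀ i, 0 < M.trajProb (Policy.deterministic πE) (D i)) (h : Fin H) {s : S} {a : A}
    (hsa : ¬(s ∈ good ∧ a = a₁)) : empirical D h s a = 0 :=
  Imitation.empirical_eq_zero D fun i hi => hsa <| by
    have := hM.mem_good_of_trajProb_pos (hD i) h
    rwa [hi] at this

lemma sum_empirical (hM : M.IsResetCliff good a₁ πE) (hm : 0 < m)
    (hD : ∀ i, 0 < M.trajProb (Policy.deterministic πE) (D i)) (h : Fin H) :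
    ∑ s ∈ good, empirical D h s a₁ = 1 := by
  rw [← sum_empiricalState D hm h, ← sum_sum_ite_mem_and_eq]
  refine Finset.sum_congr rfl fun s _ => Finset.sum_congr rfl fun a _ => ?_
  split_ifs with hsa
  · rfl
  · rw [hM.empirical_eq_zero hD h hsa]

lemma empiricalState_eq (hM : M.IsResetCliff good a₁ πE)
    (hD : ∀ i, 0 < M.trajProb (Policy.deterministic πE) (D i)) (h : Fin H) (s : S) :
    empiricalState D h s = empirical D h s a₁ :=
  Finset.sum_eq_single a₁ (fun _ _ ha => hM.empirical_eq_zero hD h fun hsa => ha hsa.2)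
    fun h => absurd (Finset.mem_univ _) h

/-- Off the good pairs the loss is the mass of `π` there, that is, one minus its mass on good pairs.
-/
lemma vailLoss_eq (hM : M.IsResetCliff good a₁ πE)
    (hD : ∀ i, 0 < M.trajProb (Policy.deterministic πE) (D i)) (π : Policy S A H) :
    M.vailLoss D π =
      ∑ h, ∑ s ∈ good, (|M.occ π h s a₁ - empirical D h s a₁| - M.occ π h s a₁) + H := by
  have h1 : ∀ h, ∑ s, ∑ a, |M.occ π h s a - empirical D h s a| =
      ∑ s ∈ good, (|M.occ π h s a₁ - empirical D h s a₁| - M.occ π h s a₁) + 1 := fun h => by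
    rw [← M.sum_stateOcc π h, ← sum_sum_ite_mem_and_eq good a₁ fun s a =>
      |M.occ π h s a - empirical D h s a| - M.occ π h s a, ← Finset.sum_add_distrib]
    refine Finset.sum_congr rfl fun s _ => ?_
    rw [stateOcc, ← Finset.sum_add_distrib]
    refine Finset.sum_congr rfl fun a _ => ?_
    split_ifs with hsa
    · ring
    · rw [hM.empirical_eq_zero hD h hsa, sub_zero, abs_of_nonneg (M.occ_nonneg π h s a), zero_add]
  rw [vailLoss, Finset.sum_congr rfl fun h _ => h1 h, Finset.sum_add_distrib]
  simp

variable {π : Policy S A H}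

/-- A minimiser of the VAIL objective matches the expert's loss in every good state. -/
lemma loss_eq_of_isVAIL (hM : M.IsResetCliff good a₁ πE)
    (hD : ∀ i, 0 < M.trajProb (Policy.deterministic πE) (D i)) (hπ : M.IsVAIL D π)
    (h : Fin H) {s : S} (hs : s ∈ good) :
    |M.occ (Policy.deterministic πE) h s a₁ - empirical D h s a₁| -
        M.occ (Policy.deterministic πE) h s a₁ =
      |M.occ π h s a₁ - empirical D h s a₁| - M.occ π h s a₁ := by
  have h1 := hπ (Policy.deterministic πE)
  rw [hM.vailLoss_eq hD, hM.vailLoss_eq hD, add_le_add_iff_right] at h1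
  have h2 : ∀ h : Fin H, ∀ s ∈ good,
      |M.occ (Policy.deterministic πE) h s a₁ - empirical D h s a₁| -
        M.occ (Policy.deterministic πE) h s a₁ ≤
      |M.occ π h s a₁ - empirical D h s a₁| - M.occ π h s a₁ := fun h s hs =>
    abs_sub_sub_self_le _ (hM.occ_le_expert π h hs)
  have h3 := fun (h : Fin H) (_ : h ∈ Finset.univ) => Finset.sum_le_sum (h2 h)
  -- The expert's terms are the smaller ones, yet minimality of `π` reverses the inequality of the
  -- sums, so all terms agree.
  have h4 := (Finset.sum_eq_sum_iff_of_le h3).1 (le_antisymm (Finset.sum_le_sum h3) h1) h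
    (Finset.mem_univ h)
  exact (Finset.sum_eq_sum_iff_of_le (h2 h)).1 h4 s hs

lemma occ_eq_expert_of_mem_good (hM : M.IsResetCliff good a₁ πE) (hm : 0 < m)
    (hD : ∀ i, 0 < M.trajProb (Policy.deterministic πE) (D i)) (hπ : M.IsVAIL D π)
    {h : Fin H} (hh : h ≠ lastStep H) {s : S} (hs : s ∈ good) :
    M.occ π h s a₁ = M.occ (Policy.deterministic πE) h s a₁ := by
  by_contra hne
  have hlt := lt_of_le_of_ne (hM.occ_le_expert π h hs) hne
  have hk := lt_of_ne_lastStep hh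
  have hlast := hM.occ_lt_expert_of_lt π (j := H - 1) hk (lastStep H).isLt hs hlt
  have h1 : ∑ s ∈ good, M.occ π (lastStep H) s a₁ < 1 := by
    rw [← hM.sum_occ_expert (lastStep H)]
    exact Finset.sum_lt_sum_of_nonempty ⟨s, hs⟩ hlast
  rw [← hM.sum_empirical hm hD (lastStep H)] at h1
  refine h1.not_ge (Finset.sum_le_sum fun s hs => ?_)
  exact le_of_abs_sub_sub_self_eq (hlast s hs) (hM.loss_eq_of_isVAIL hD hπ (lastStep H) hs)

lemma occ_eq_expert (hM : M.IsResetCliff good a₁ πE) (hm : 0 < m)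
    (hD : ∀ i, 0 < M.trajProb (Policy.deterministic πE) (D i)) (hπ : M.IsVAIL D π)
    {h : Fin H} (hh : h ≠ lastStep H) (s : S) (a : A) :
    M.occ π h s a = M.occ (Policy.deterministic πE) h s a := by
  have h1 := fun s hs => hM.occ_eq_expert_of_mem_good hm hD hπ hh (s := s) hs
  by_cases hsa : s ∈ good ∧ a = a₁
  · rw [hsa.2, h1 s hsa.1]
  · rw [occ_eq_zero (hM.sum_occ_expert h) hsa, occ_eq_zero _ hsa]
    rw [← hM.sum_occ_expert h]
    exact Finset.sum_congr rfl h1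

lemma value_gap_eq (hM : M.IsResetCliff good a₁ πE) (hm : 0 < m)
    (hD : ∀ i, 0 < M.trajProb (Policy.deterministic πE) (D i)) (hπ : M.IsVAIL D π) :
    M.value (Policy.deterministic πE) - M.value π =
      ∑ s ∈ good, (M.occ (Policy.deterministic πE) (lastStep H) s a₁ -
        M.occ π (lastStep H) s a₁) := by
  rw [Finset.sum_sub_distrib, hM.value_eq, hM.value_eq, ← Finset.sum_sub_distrib]
  refine Finset.sum_eq_single (lastStep H) (fun h _ hh => ?_)
    fun h => absurd (Finset.mem_univ _) h
  rw [sub_eq_zero]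
  exact Finset.sum_congr rfl fun s hs => (hM.occ_eq_expert_of_mem_good hm hD hπ hh hs).symm

lemma value_gap_eq_reward (hM : M.IsResetCliff good a₁ πE) (hm : 0 < m)
    (hD : ∀ i, 0 < M.trajProb (Policy.deterministic πE) (D i)) (hπ : M.IsVAIL D π) :
    M.value (Policy.deterministic πE) - M.value π =
      ∑ s, ∑ a, (M.occ (Policy.deterministic πE) (lastStep H) s a
        - M.occ π (lastStep H) s a) * M.reward (lastStep H) s a := by
  rw [hM.value_gap_eq hm hD hπ, ← sum_sum_ite_mem_and_eq good a₁ fun s a =>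
    M.occ (Policy.deterministic πE) (lastStep H) s a - M.occ π (lastStep H) s a]
  refine Finset.sum_congr rfl fun s _ => Finset.sum_congr rfl fun a _ => ?_
  rw [hM.reward_eq]
  split_ifs <;> simp

lemma value_le_expert (hM : M.IsResetCliff good a₁ πE) (π : Policy S A H) :
    M.value π ≤ M.value (Policy.deterministic πE) := by
  rw [hM.value_eq, hM.value_eq]
  exact Finset.sum_le_sum fun h _ => Finset.sum_le_sum fun s hs => hM.occ_le_expert π h hs

/-- The value gap is at most the total variation distance between the empirical and the expert
state distributions of the last step. -/
lemma value_gap_le (hM : M.IsResetCliff good a₁ πE) (hm : 0 < m)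
    (hD : ∀ i, 0 < M.trajProb (Policy.deterministic πE) (D i)) (hπ : M.IsVAIL D π) :
    M.value (Policy.deterministic πE) - M.value π ≤
      ∑ s, max (M.stateOcc (Policy.deterministic πE) (lastStep H) s -
        empiricalState D (lastStep H) s) 0 := by
  rw [hM.value_gap_eq hm hD hπ]
  refine (Finset.sum_le_sum fun s hs => ?_).trans (Finset.sum_le_sum_of_subset_of_nonneg
    (Finset.subset_univ good) fun s _ _ => le_max_right _ _)
  rw [hM.empiricalState_eq hD, ← hM.occ_expert _ hs]
  -- Either the term of the gap vanishes, or `p ≤ x` and then `e - x ≤ e - p`.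
  rcases (hM.occ_le_expert π (lastStep H) hs).eq_or_lt with heq | hlt
  · rw [heq, sub_self]
    exact le_max_right _ _
  · refine le_max_of_le_left (sub_le_sub_left ?_ _)
    exact le_of_abs_sub_sub_self_eq hlt (hM.loss_eq_of_isVAIL hD hπ (lastStep H) hs)

lemma abs_value_gap_le (hM : M.IsResetCliff good a₁ πE) (hm : 0 < m)
    (hD : ∀ i, 0 < M.trajProb (Policy.deterministic πE) (D i)) (hπ : M.IsVAIL D π) :
    |M.value (Policy.deterministic πE) - M.value π| ≤
      2 * ∑ s, |empiricalState D (lastStep H) s -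
        M.stateOcc (Policy.deterministic πE) (lastStep H) s| := by
  rw [abs_of_nonneg (sub_nonneg.2 (hM.value_le_expert π)), Finset.mul_sum]
  refine (hM.value_gap_le hm hD hπ).trans (Finset.sum_le_sum fun s _ => ?_)
  rw [abs_sub_comm]
  have h1 := abs_nonneg (M.stateOcc (Policy.deterministic πE) (lastStep H) s -
    empiricalState D (lastStep H) s)
  have h2 := le_abs_self (M.stateOcc (Policy.deterministic πE) (lastStep H) s -
    empiricalState D (lastStep H) s)
  exact max_le (by linarith) (by linarith)

end Dataset

end MDP.IsResetCliff

end

/-! ### Concentration of the empirical state distribution -/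

section

variable {S A : Type*} [Fintype S] [Fintype A] [DecidableEq S] [DecidableEq A] {H : ℕ} [NeZero H]

/-- Failure probabilities from Hoeffding's inequality for all subsets of an `n`-element set add up to at most `δ`. -/
lemma two_pow_mul_exp_le {n m : ℕ} (hn : 1 ≤ n) {ε δ : ℝ} (hε : 0 < ε) (hδ : 0 < δ) (hδ' : δ < 1)
    (hm : 8 * (n : ℝ) * Real.log (2 / δ) / ε ^ 2 ≤ m) :
    2 ^ n * Real.exp (-(2 * m * ε ^ 2)) ≤ δ := by
  have hlog : 0 < Real.log (2 / δ) := Real.log_pos (by rw [lt_div_iff₀ hδ]; linarith)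
  rw [div_le_iff₀ (by positivity)] at hm
  have h1 : Real.exp (-(2 * m * ε ^ 2)) ≤ (δ / 2) ^ n := by
    have h2 : δ / 2 = Real.exp (-Real.log (2 / δ)) := by
      rw [← Real.log_inv, Real.exp_log (by positivity), inv_div]
    rw [h2, ← Real.exp_nat_mul, Real.exp_le_exp]
    -- The hypothesis gives `2mε² ≥ 16 n log (2/δ)`; a sixteenth of this suffices.
    have h3 : 0 ≤ (n : ℝ) * Real.log (2 / δ) := by positivity
    linarith
  calc 2 ^ n * Real.exp (-(2 * m * ε ^ 2)) ≤ 2 ^ n * (δ / 2) ^ n := by gcongr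
    _ = δ ^ n := by rw [← mul_pow]; congr 1; ring
    _ ≤ δ := pow_le_of_le_one hδ.le hδ'.le (by omega)

namespace MDP

/-- Policy values are polynomials in the action probabilities. -/
lemma aemeasurable_value (M : MDP S A H) {Ω : Type*} [MeasurableSpace Ω] {μ : Measure Ω}
    {π : Ω → Policy S A H} (hπ : ∀ h s a, AEMeasurable (fun ω => (π ω).prob h s a) μ) :
    AEMeasurable (fun ω => M.value (π ω)) μ := by
  unfold value trajProb
  refine Finset.aemeasurable_fun_sum _ fun τ _ => AEMeasurable.mul_const ?_ _
  exact ((Finset.aemeasurable_fun_prod _ fun h _ => hπ h _ _).const_mul _).mul_const _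

lemma value_nonneg (M : MDP S A H) (π : Policy S A H) : 0 ≤ M.value π :=
  Finset.sum_nonneg fun _ _ => mul_nonneg (M.trajProb_nonneg _ _)
    (Finset.sum_nonneg fun _ _ => M.reward_nonneg _ _ _)

lemma value_le (M : MDP S A H) (π : Policy S A H) : M.value π ≤ H := by
  calc M.value π ≤ ∑ τ, M.trajProb π τ * H := by
        refine Finset.sum_le_sum fun τ _ => mul_le_mul_of_nonneg_left ?_ (M.trajProb_nonneg _ _)
        refine (Finset.sum_le_sum fun h _ => M.reward_le_one h (τ h).1 (τ h).2).trans ?_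
        simp
    _ = H := by rw [← Finset.sum_mul, M.sum_trajProb, one_mul]

lemma integrable_value (M : MDP S A H) {Ω : Type*} [MeasurableSpace Ω] {μ : Measure Ω}
    [IsFiniteMeasure μ] {π : Ω → Policy S A H}
    (hπ : ∀ h s a, AEMeasurable (fun ω => (π ω).prob h s a) μ) :
    Integrable (fun ω => M.value (π ω)) μ :=
  Integrable.of_mem_Icc 0 H (M.aemeasurable_value hπ)
    (Filter.Eventually.of_forall fun _ => ⟨M.value_nonneg _, M.value_le _⟩)

lemma stateOcc_nonneg (M : MDP S A H) (π : Policy S A H) (h : Fin H) (s : S) :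
    0 ≤ M.stateOcc π h s :=
  Finset.sum_nonneg fun _ _ => M.occ_nonneg _ _ _ _

/-- The number of states of a Markov decision process is positive. -/
lemma one_le_card (M : MDP S A H) : (1 : ℝ) ≤ Fintype.card S := by
  have : Nonempty S := by
    by_contra h
    have := not_nonempty_iff.1 h
    simpa using M.init_sum
  exact_mod_cast Fintype.card_pos

namespace IsSample

variable {M : MDP S A H} {π : Policy S A H} {Ω : Type*} [MeasurableSpace Ω] {μ : Measure Ω}
  {m : ℕ} {D : Fin m → Ω → Trajectory S A H}

lemma measurable (hD : M.IsSample π μ D) (i : Fin m) : @Measurable _ _ _ ⊤ (D i) := by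
  let _ : MeasurableSpace (Trajectory S A H) := ⊤
  exact measurable_to_countable' (hD.measurableSet_eq i)

lemma measurable_comp (hD : M.IsSample π μ D) (i : Fin m) (f : Trajectory S A H → ℝ) :
    Measurable fun ω => f (D i ω) := by
  let _ : MeasurableSpace (Trajectory S A H) := ⊤
  exact (measurable_from_top (f := f)).comp (hD.measurable i)

variable [IsProbabilityMeasure μ]

lemma integral_comp (hD : M.IsSample π μ D) (i : Fin m) (f : Trajectory S A H → ℝ) :
    ∫ ω, f (D i ω) ∂μ = ∑ τ, M.trajProb π τ * f τ := by
  have h1 : ∀ ω, f (D i ω) = ∑ τ, {ω | D i ω = τ}.indicator (fun _ => f τ) ω := fun ω => by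
    simp [Set.indicator_apply]
  simp only [h1]
  rw [integral_finsetSum _ fun τ _ =>
    (integrable_const (f τ)).indicator (hD.measurableSet_eq i τ)]
  refine Finset.sum_congr rfl fun τ _ => ?_
  rw [integral_indicator_const _ (hD.measurableSet_eq i τ), hD.law, smul_eq_mul]

lemma integral_mem (hD : M.IsSample π μ D) (i : Fin m) (h : Fin H) (B : Finset S) :
    ∫ ω, (if (D i ω h).1 ∈ B then (1 : ℝ) else 0) ∂μ = ∑ s ∈ B, M.stateOcc π h s := by
  rw [hD.integral_comp i fun τ => if (τ h).1 ∈ B then (1 : ℝ) else 0,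
    M.sum_trajProb_mul π h fun x => if x.1 ∈ B then (1 : ℝ) else 0]
  simp only [stateOcc]
  simp

/-- Almost surely, the dataset consists of trajectories of positive probability. -/
lemma ae_trajProb_pos (hD : M.IsSample π μ D) : ∀ᵐ ω ∂μ, ∀ i, 0 < M.trajProb π (D i ω) := by
  rw [ae_all_iff]
  intro i
  have h1 : ∀ᵐ ω ∂μ, ∀ τ, M.trajProb π τ = 0 → D i ω ≠ τ := by
    rw [ae_all_iff]
    intro τ
    by_cases hτ : M.trajProb π τ = 0
    · have h2 := hD.law i τ
      rw [hτ, measureReal_eq_zero_iff] at h2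
      filter_upwards [measure_eq_zero_iff_ae_notMem.1 h2] with ω hω _ using hω
    · exact Filter.Eventually.of_forall fun _ h => absurd h hτ
  filter_upwards [h1] with ω hω
  exact lt_of_le_of_ne (M.trajProb_nonneg _ _) fun h => hω _ h.symm rfl

lemma iIndepFun_comp (hD : M.IsSample π μ D) (f : Trajectory S A H → ℝ) :
    iIndepFun (fun i ω => f (D i ω)) μ := by
  let _ : MeasurableSpace (Trajectory S A H) := ⊤
  exact hD.indep.comp (fun _ => f) fun _ => measurable_from_top

/-- **Hoeffding's inequality** for the empirical probability of a set of states. -/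
lemma hoeffding (hD : M.IsSample π μ D) (hm : 0 < m) (h : Fin H) (B : Finset S) {ε : ℝ}
    (hε : 0 ≤ ε) :
    μ.real {ω | ε ≤ ∑ s ∈ B, (M.stateOcc π h s - empiricalState (fun i => D i ω) h s)} ≤
      Real.exp (-(2 * m * ε ^ 2)) := by
  have hm' : (0 : ℝ) < m := Nat.cast_pos.2 hm
  -- The sign turns an underestimate of the mass of `B` into an upper tail. Values in `[-1, 0]` give
  -- the sub-Gaussian parameter `1/4`.
  let f : Trajectory S A H → ℝ := fun τ => -(if (τ h).1 ∈ B then (1 : ℝ) else 0)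
  have hf : ∀ i, μ[fun ω => f (D i ω)] = -∑ s ∈ B, M.stateOcc π h s := fun i => by
    simp only [f, integral_neg]
    rw [hD.integral_mem]
  have h1 : ∀ i ∈ Finset.univ, HasSubgaussianMGF
      (fun ω => f (D i ω) - μ[fun ω => f (D i ω)]) ((‖(0 : ℝ) - (-1)‖₊ / 2) ^ 2) μ := fun i _ =>
    hasSubgaussianMGF_of_mem_Icc (hD.measurable_comp i f).aemeasurable <|
      Filter.Eventually.of_forall fun ω => by
        simp only [f]
        split_ifs <;> simp
  simp only [hf] at h1
  have h2 := HasSubgaussianMGF.measure_sum_ge_le_of_iIndepFun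
    (hD.iIndepFun_comp fun τ => f τ - -∑ s ∈ B, M.stateOcc π h s) h1
    (mul_nonneg hm'.le hε)
  have h3 : -(m * ε) ^ 2 / (2 * ((∑ i : Fin m, (‖(0 : ℝ) - (-1)‖₊ / 2) ^ 2 : NNReal) : ℝ)) =
      -(2 * m * ε ^ 2) := by
    simp
    field_simp
  rw [h3] at h2
  refine le_trans (le_of_eq ?_) h2
  congr 1
  ext ω
  have h4 : ∑ i : Fin m, (f (D i ω) - -∑ s ∈ B, M.stateOcc π h s) =
      m * ∑ s ∈ B, (M.stateOcc π h s - empiricalState (fun i => D i ω) h s) := by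
    simp only [f, Finset.sum_sub_distrib, empiricalState_eq_sum, ← Finset.sum_div]
    rw [Finset.sum_comm]
    simp
    field_simp
    ring
  simp only [Set.mem_ofPred_eq]
  rw [h4, mul_le_mul_iff_right₀ hm']

lemma measurable_empiricalState (hD : M.IsSample π μ D) (h : Fin H) (s : S) :
    Measurable fun ω => empiricalState (fun i => D i ω) h s := by
  simp only [empiricalState_eq_sum]
  exact (Finset.measurable_fun_sum _ fun i _ =>
    hD.measurable_comp i fun τ => if (τ h).1 = s then (1 : ℝ) else 0).div_const _

/-- The empirical state distribution is an unbiased estimator with variance at most `P^π_h(s) / m`. -/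
lemma integral_sq_le (hD : M.IsSample π μ D) (hm : 0 < m) (h : Fin H) (s : S) :
    ∫ ω, (M.stateOcc π h s - empiricalState (fun i => D i ω) h s) ^ 2 ∂μ ≤
      M.stateOcc π h s / m := by
  have hm' : (0 : ℝ) < m := Nat.cast_pos.2 hm
  let f : Trajectory S A H → ℝ := fun τ => if (τ h).1 = s then 1 else 0
  have hf : ∀ i, μ[fun ω => f (D i ω)] = M.stateOcc π h s := fun i => by
    simpa [f] using hD.integral_mem i h {s}
  have hL : ∀ i, MemLp (fun ω => f (D i ω)) 2 μ := fun i =>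
    MemLp.of_bound (hD.measurable_comp i f).aestronglyMeasurable 1 <|
      Filter.Eventually.of_forall fun ω => by
        simp only [f]
        split_ifs <;> simp
  have hv : ∀ i, Var[fun ω => f (D i ω); μ] ≤ M.stateOcc π h s := fun i => by
    refine (variance_le_expectation_sq (hD.measurable_comp i f).aestronglyMeasurable).trans ?_
    rw [← hf i]
    -- An indicator equals its square, so its second moment is its mean.
    refine le_of_eq (integral_congr_ae (Filter.Eventually.of_forall fun ω => ?_))
    simp only [f, Pi.pow_apply]
    split_ifs <;> simp
  have h1 : Var[∑ i, fun ω => f (D i ω); μ] ≤ m * M.stateOcc π h s := by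
    rw [IndepFun.variance_sum (fun i _ => hL i)
      fun i _ j _ hij => (hD.iIndepFun_comp f).indepFun hij]
    refine (Finset.sum_le_sum fun i _ => hv i).trans ?_
    simp
  have hmean : μ[∑ i, fun ω => f (D i ω)] = m * M.stateOcc π h s := by
    simp only [Finset.sum_apply]
    rw [integral_finsetSum _ fun i _ => (hL i).integrable (by norm_num)]
    simp [hf]
  rw [variance_eq_integral (Finset.aemeasurable_sum _ fun i _ =>
    (hD.measurable_comp i f).aemeasurable), hmean] at h1
  have h2 : ∀ ω, (M.stateOcc π h s - empiricalState (fun i => D i ω) h s) ^ 2 =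
      ((∑ i, fun ω => f (D i ω)) ω - m * M.stateOcc π h s) ^ 2 / m ^ 2 := fun ω => by
    simp only [empiricalState_eq_sum, Finset.sum_apply, f]
    field_simp
    ring
  simp only [h2]
  rw [integral_div, div_le_div_iff₀ (by positivity) hm']
  nlinarith [mul_le_mul_of_nonneg_right h1 hm'.le]

end IsSample

/-! ### Sample complexity bounds -/

namespace IsResetCliff

variable {M : MDP S A H} {good : Finset S} {a₁ : A} {πE : Fin H → S → A}
  {Ω : Type*} [MeasurableSpace Ω] {μ : Measure Ω} [IsProbabilityMeasure μ]
  {m : ℕ} {D : Fin m → Ω → Trajectory S A H} {πAIL : Ω → Policy S A H}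

/-- Young's inequality `d ≤ (c/ε) d² + ε/(4c)`, with `c = |S|`, replaces Cauchy–Schwarz. Summed over
states, the expectation is at most `c/(εm) + ε/4`, where `c/(εm) ≤ ε/4`. -/
lemma value_sub_integral_le (hM : M.IsResetCliff good a₁ πE) (hm : 0 < m)
    (hD : M.IsSample (Policy.deterministic πE) μ D)
    (hπ : ∀ h s a, AEMeasurable (fun ω => (πAIL ω).prob h s a) μ)
    (hV : ∀ᵐ ω ∂μ, M.IsVAIL (fun i => D i ω) (πAIL ω)) {ε : ℝ} (hε : 0 < ε)
    (hmε : 4 * (Fintype.card S : ℝ) / ε ^ 2 ≤ m) :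
    M.value (Policy.deterministic πE) - ∫ ω, M.value (πAIL ω) ∂μ ≤ ε := by
  have hm' : (0 : ℝ) < m := Nat.cast_pos.2 hm
  have hcard := M.one_le_card
  set p := M.stateOcc (Policy.deterministic πE) (lastStep H)
  have hsum : ∑ s, p s = 1 := M.sum_stateOcc _ _
  set c : ℝ := (Fintype.card S : ℝ)
  let d : S → Ω → ℝ := fun s ω => p s - empiricalState (fun i => D i ω) (lastStep H) s
  have hdm : ∀ s, Measurable (d s) := fun s =>
    measurable_const.sub (hD.measurable_empiricalState _ s)
  have hd1 : ∀ s ω, |d s ω| ≤ 1 := fun s ω => by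
    have h1 : 0 ≤ empiricalState (fun i => D i ω) (lastStep H) s := by
      rw [empiricalState_eq_sum]
      positivity
    have h2 : empiricalState (fun i => D i ω) (lastStep H) s ≤ 1 := by
      rw [← sum_empiricalState (fun i => D i ω) hm (lastStep H)]
      exact Finset.single_le_sum (f := empiricalState (fun i => D i ω) (lastStep H))
        (fun s _ => by rw [empiricalState_eq_sum]; positivity) (Finset.mem_univ s)
    have h3 : 0 ≤ p s := M.stateOcc_nonneg _ _ _
    have h4 : p s ≤ 1 := by
      rw [← hsum]
      exact Finset.single_le_sum (fun s _ => M.stateOcc_nonneg _ _ s) (Finset.mem_univ s)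
    exact abs_le.2 ⟨by simp only [d]; linarith, by simp only [d]; linarith⟩
  have hint : ∀ s, Integrable (fun ω => d s ω ^ 2) μ := fun s =>
    Integrable.of_mem_Icc 0 1 ((hdm s).pow_const 2).aemeasurable <|
      Filter.Eventually.of_forall fun ω => ⟨sq_nonneg _, (sq_le_one_iff_abs_le_one _).2 (hd1 s ω)⟩
  have hgap : ∀ᵐ ω ∂μ, M.value (Policy.deterministic πE) - M.value (πAIL ω) ≤
      ∑ s, (c / ε * d s ω ^ 2 + ε / (4 * c)) := by
    filter_upwards [hV, hD.ae_trajProb_pos] with ω h1 h2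
    refine (hM.value_gap_le hm h2 h1).trans (Finset.sum_le_sum fun s _ => ?_)
    refine max_le ?_ (by positivity)
    have h3 : c / ε * d s ω ^ 2 + ε / (4 * c) - d s ω =
        (2 * c * d s ω - ε) ^ 2 / (4 * c * ε) := by
      field_simp
      ring
    have h4 : 0 ≤ (2 * c * d s ω - ε) ^ 2 / (4 * c * ε) := by positivity
    change d s ω ≤ _
    linarith
  have hint' : ∀ s, Integrable (fun ω => c / ε * d s ω ^ 2 + ε / (4 * c)) μ := fun s =>
    ((hint s).const_mul _).add (integrable_const _)
  have hval := M.integrable_value hπ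
  have h1 := integral_mono_ae ((integrable_const _).sub hval)
    (integrable_finsetSum Finset.univ fun s _ => hint' s) hgap
  simp only [Pi.sub_apply] at h1
  rw [integral_sub (integrable_const _) hval, integral_finsetSum _ fun s _ => hint' s] at h1
  have h2 : ∀ s, ∫ ω, (c / ε * d s ω ^ 2 + ε / (4 * c)) ∂μ ≤
      c / ε * (p s / m) + ε / (4 * c) := fun s => by
    rw [integral_add ((hint s).const_mul _) (integrable_const _), integral_const_mul]
    have := mul_le_mul_of_nonneg_left (hD.integral_sq_le hm (lastStep H) s)
      (show 0 ≤ c / ε by positivity)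
    simpa using this
  have h3 := h1.trans (Finset.sum_le_sum fun s _ => h2 s)
  rw [Finset.sum_add_distrib, ← Finset.mul_sum, ← Finset.sum_div, hsum] at h3
  simp only [integral_const, probReal_univ, one_smul, Finset.sum_const, Finset.card_univ,
    nsmul_eq_mul] at h3
  have h4 : c * (ε / (4 * c)) = ε / 4 := by field_simp
  have h5 : c / ε * (1 / m) ≤ ε / 4 := by
    rw [div_le_iff₀ (by positivity)] at hmε
    rw [div_mul_div_comm, mul_one, div_le_iff₀ (by positivity)]
    nlinarith
  change _ ≤ _ + c * (ε / (4 * c)) at h3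
  linarith

/-- A sum of positive parts is a plain sum over the set of states where the summand is nonnegative.
That set is random, so the union bound runs over all `2^|S|` subsets. -/
lemma one_sub_le_measureReal (hM : M.IsResetCliff good a₁ πE) (hm : 0 < m)
    (hD : M.IsSample (Policy.deterministic πE) μ D)
    (hV : ∀ᵐ ω ∂μ, M.IsVAIL (fun i => D i ω) (πAIL ω)) {ε δ : ℝ} (hε : 0 < ε)
    (hδ : 0 < δ) (hδ' : δ < 1)
    (hmε : 8 * (Fintype.card S : ℝ) * Real.log (2 / δ) / ε ^ 2 ≤ m) :
    1 - δ ≤ μ.real {ω | M.value (Policy.deterministic πE) - M.value (πAIL ω) ≤ ε} := by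
  set p := M.stateOcc (Policy.deterministic πE) (lastStep H)
  let F : Finset S → Set Ω := fun B =>
    {ω | ε ≤ ∑ s ∈ B, (p s - empiricalState (fun i => D i ω) (lastStep H) s)}
  have hF : μ.real (⋃ B, F B) ≤ δ := by
    refine (measureReal_iUnion_fintype_le F).trans ?_
    refine (Finset.sum_le_sum fun B _ => hD.hoeffding hm (lastStep H) B hε.le).trans ?_
    simpa using two_pow_mul_exp_le (by exact_mod_cast M.one_le_card) hε hδ hδ' hmε
  have hcover : ∀ᵐ ω ∂μ, ω ∈ {ω | M.value (Policy.deterministic πE) - M.value (πAIL ω) ≤ ε} ∪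
      ⋃ B, F B := by
    filter_upwards [hV, hD.ae_trajProb_pos] with ω h1 h2
    by_cases hω : M.value (Policy.deterministic πE) - M.value (πAIL ω) ≤ ε
    · exact Or.inl hω
    · refine Or.inr (Set.mem_iUnion.2 ⟨Finset.univ.filter fun s =>
        0 ≤ p s - empiricalState (fun i => D i ω) (lastStep H) s, ?_⟩)
      refine (not_le.1 hω).le.trans ((hM.value_gap_le hm h2 h1).trans (le_of_eq ?_))
      rw [Finset.sum_filter]
      refine Finset.sum_congr rfl fun s _ => ?_
      split_ifs with hs
      · exact max_eq_left hs
      · exact max_eq_right (not_le.1 hs).le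
  -- Subadditivity holds for arbitrary sets, so the gap event need not be shown measurable.
  have h1 := measureReal_union_le (μ := μ)
    {ω | M.value (Policy.deterministic πE) - M.value (πAIL ω) ≤ ε} (⋃ B, F B)
  have h2 : μ.real ({ω | M.value (Policy.deterministic πE) - M.value (πAIL ω) ≤ ε} ∪ ⋃ B, F B) = 1 :=
    (measureReal_congr (Filter.eventuallyEq_univ.2 hcover)).trans probReal_univ
  linarith

end IsResetCliff

end MDP

end

end Imitation

theorem mainTheorem6 {S A : Type*} [Fintype S] [Fintype A] [DecidableEq S] [DecidableEq A]
    {H : ℕ} [NeZero H] (M : Imitation.MDP S A H) (good : Finset S) (a₁ : A)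
    (πE : Fin H → S → A) (hM : M.IsResetCliff good a₁ πE) (m : ℕ) (hm : 0 < m) :
    (∀ D : Fin m → Imitation.Trajectory S A H,
      (∀ i, 0 < M.trajProb (Imitation.Policy.deterministic πE) (D i)) →
      ∀ π : Imitation.Policy S A H, M.IsVAIL D π →
        (∀ h, h ≠ Imitation.lastStep H → ∀ s a,
          M.occ π h s a = M.occ (Imitation.Policy.deterministic πE) h s a) ∧
        M.value (Imitation.Policy.deterministic πE) - M.value π =
          ∑ s, ∑ a, (M.occ (Imitation.Policy.deterministic πE) (Imitation.lastStep H) s a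
            - M.occ π (Imitation.lastStep H) s a) * M.reward (Imitation.lastStep H) s a ∧
        |M.value (Imitation.Policy.deterministic πE) - M.value π| ≤
          2 * ∑ s, |Imitation.empiricalState D (Imitation.lastStep H) s
            - M.stateOcc (Imitation.Policy.deterministic πE) (Imitation.lastStep H) s|) ∧
    (∀ {Ω : Type*} [MeasurableSpace Ω] (μ : MeasureTheory.Measure Ω)
      [MeasureTheory.IsProbabilityMeasure μ] (D : Fin m → Ω → Imitation.Trajectory S A H)
      (πAIL : Ω → Imitation.Policy S A H),
      M.IsSample (Imitation.Policy.deterministic πE) μ D →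
      (∀ h s a, AEMeasurable (fun ω => (πAIL ω).prob h s a) μ) →
      (∀ᵐ ω ∂μ, M.IsVAIL (fun i => D i ω) (πAIL ω)) →
        MeasureTheory.Integrable (fun ω => M.value (πAIL ω)) μ ∧
        (∀ ε : ℝ, 0 < ε → 4 * (Fintype.card S : ℝ) / ε ^ 2 ≤ m →
          M.value (Imitation.Policy.deterministic πE) - ∫ ω, M.value (πAIL ω) ∂μ ≤ ε) ∧
        (∀ ε δ : ℝ, 0 < ε → 0 < δ → δ < 1 →
          8 * (Fintype.card S : ℝ) * Real.log (2 / δ) / ε ^ 2 ≤ m →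
          1 - δ ≤ μ.real {ω |
            M.value (Imitation.Policy.deterministic πE) - M.value (πAIL ω) ≤ ε})) := by
  refine ⟨fun D hD π hπ => ⟨fun h hh s a => hM.occ_eq_expert hm hD hπ hh s a,
    hM.value_gap_eq_reward hm hD hπ, hM.abs_value_gap_le hm hD hπ⟩, ?_⟩
  intro Ω _ μ _ D πAIL hD hmeas hV
  exact ⟨M.integrable_value hmeas,
    fun ε hε hmε => hM.value_sub_integral_le hm hD hmeas hV hε hmε,
    fun ε δ hε hδ hδ' hmε => hM.one_sub_le_measureReal hm hD hV hε hδ hδ' hmε⟩
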